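/- Let $E_m$ and $E_m(x)$ denote the Euler numbers and Euler polynomials, defined by $$\frac{2}{e^t+e^{-t}}=\sum_{m\ge 0}E_m\frac{t^m}{m!},\qquad \frac{2e^{xt}}{e^t+1}=\sum_{m\ge 0}E_m(x)\frac{t^m}{m!},$$ and for a sequence $(c_k)_{k\ge 0}$ let $H_n(c_k)=\det(c_{i+j})_{0\le i,j\le n}$ be its Hankel determinant. Let $b_0(x)=0$ and $b_k(x)=E_{2k-2}\big(\tfrac{x+1}{2}\big)$ for $k\ge 1$. Then for all $n\ge 1$, as an identity of rational functions in $\mathbb{Q}(x)$, $$H_n\big(b_k(x)\big)=(-1)^{n-1}\frac{4}{n!^2(x^2-1)}\cdot\mathcal{K}_n(x)\cdot H_n\big(E_{2k}(\tfrac{x+1}{2})\big),$$ where $$\mathcal{K}_n(x)=1+\sum_{j=1}^{n-1}\prod_{i=1}^{j}\frac{(2i)^2}{(2i+1)^2-x^2},$$ so that $\mathcal{K}_1(x)=1$. The identity also holds for every complex number $x$ with $x^2\ne(2\ell-1)^2$ for $1\le\ell\le n$. Moreover, in the specialization to Euler numbers, if $b_0=0$ and $b_k=E_{2k-2}$ for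 $k\ge 1$, then for all $n\ge 1$ $$H_n(b_k)=\frac{(-1)^n}{4^n\,n!^2}\left(\sum_{j=0}^{n-1}\frac{16^j}{(2j+1)^2\binom{2j}{j}^2}\right)H_n(E_{2k}).$$ -/

import Mathlib

open Polynomial

/-- The Hankel determinant `H_n(c) = det (c_{i+j})_{0 ≤ i,j ≤ n}`, of size `n + 1`. -/
def hankelDet {R : Type*} [CommRing R] (n : ℕ) (c : ℕ → R) : R :=
  Matrix.det (Matrix.of fun i j : Fin (n + 1) => c ((i : ℕ) + (j : ℕ)))

/-- The Euler numbers, `2 / (e^t + e^{-t}) = ∑ E_n t^n / n!`. The inverse is that of formal power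
series over `ℚ`; the constant term of `e^t + e^{-t}` is `2`. -/
noncomputable def eulerNumber (n : ℕ) : ℚ :=
  (n.factorial : ℚ) * PowerSeries.coeff n
    (2 * (PowerSeries.exp ℚ + PowerSeries.rescale (-1 : ℚ) (PowerSeries.exp ℚ))⁻¹)

/-- The Euler polynomials, `2 e^{xt} / (e^t + 1) = ∑ E_n(x) t^n / n!`, as formal power series in `t`
over `ℚ[x]`. The factor `2 / (e^t + 1)` has rational coefficients; the constant term of `e^t + 1`
is `2`. -/
noncomputable def eulerPoly (n : ℕ) : ℚ[X] :=
  (n.factorial : ℚ[X]) * PowerSeries.coeff n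
    (PowerSeries.map (C : ℚ →+* ℚ[X]) (2 * (PowerSeries.exp ℚ + 1)⁻¹) *
      PowerSeries.rescale (X : ℚ[X]) (PowerSeries.exp ℚ[X]))

/-- The polynomial `E_m((x + 1) / 2)` in `x`. -/
noncomputable def eulerPolyHalf (m : ℕ) : ℚ[X] :=
  (eulerPoly m).comp (C (1 / 2 : ℚ) * (X + 1))

/-- The sequence `b_0(x) = 0`, `b_k(x) = E_{2k-2}((x + 1) / 2)` for `k ≥ 1`. -/
noncomputable def shiftedEulerPoly : ℕ → ℚ[X]
  | 0 => 0
  | k + 1 => eulerPolyHalf (2 * k)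

/-- The sequence `b_0 = 0`, `b_k = E_{2k-2}` for `k ≥ 1`. -/
noncomputable def shiftedEulerNumber : ℕ → ℚ
  | 0 => 0
  | k + 1 => eulerNumber (2 * k)

/-- `𝓚_n(x) = 1 + ∑_{j=1}^{n-1} ∏_{i=1}^{j} (2i)² / ((2i+1)² - x²)`, for `x` in a field: an element
of the field of rational functions, or a number that is not a pole. -/
def curlyK {F : Type*} [Field F] (n : ℕ) (x : F) : F :=
  1 + ∑ j ∈ Finset.Icc 1 (n - 1), ∏ i ∈ Finset.Icc 1 j,
    (2 * (i : F)) ^ 2 / ((2 * (i : F) + 1) ^ 2 - x ^ 2)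

/-! Put `v = x²/4` and let `L` have moments `E_{2k}((x+1)/2)`. In the basis `s_k = ∏_{j<k} (X - j²)`
its values factor: `L(s_k) = h_k = ∏_{j<k} (v - (j+1/2)²)` (`momentFunctional_eulerPolyHalf`). Hence
`p_n = ∑ (-1)^k (n choose k) s_k / h_k` is orthogonal to all lower degrees, with `L(X^n p_n) = n!²`
(`altSum_mulOp_iterate`).

Let `B` have moments `b_k`, so that `B(X p) = L(p)`. The coefficient vector of `p_n` is sent by the
Hankel matrix of `L` to `n!²` in the last row, and by that of `B` to `B(p_n)` in row `0`. Cramer's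
rule expresses both determinants through the same minor, so their ratio is `(-1)^n B(p_n) / n!²`
(`hankelDet_shift`). Since `b_0 = 0`, a first-order recurrence for the increments of `B(p_n)` in `n`
produces the sum of products. -/

/-! ### Alternating binomial sums. -/

/-- The alternating binomial sum `∑ (-1)^k (n choose k) f k`. -/
def altSum {F : Type*} [CommRing F] (n : ℕ) (f : ℕ → F) : F :=
  ∑ k ∈ Finset.range (n + 1), (-1) ^ k * (n.choose k : F) * f k

theorem altSum_zero {F : Type*} [CommRing F] (f : ℕ → F) : altSum 0 f = f 0 := by
  simp [altSum]

theorem altSum_add {F : Type*} [CommRing F] (n : ℕ) (f g : ℕ → F) :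
    altSum n (fun k => f k + g k) = altSum n f + altSum n g := by
  simp [altSum, mul_add, Finset.sum_add_distrib]

theorem altSum_const_mul {F : Type*} [CommRing F] (n : ℕ) (a : F) (f : ℕ → F) :
    altSum n (fun k => a * f k) = a * altSum n f := by
  simp only [altSum, Finset.mul_sum]
  exact Finset.sum_congr rfl fun k _ => by ring

theorem altSum_congr {F : Type*} [CommRing F] {n : ℕ} {f g : ℕ → F}
    (h : ∀ k ≤ n, f k = g k) : altSum n f = altSum n g :=
  Finset.sum_congr rfl fun k hk => by rw [h k (by simpa [Nat.lt_succ_iff] using hk)]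

theorem altSum_succ {F : Type*} [CommRing F] (n : ℕ) (f : ℕ → F) :
    altSum (n + 1) f = altSum n f - altSum n (fun k => f (k + 1)) := by
  have h1 : altSum n f = ∑ k ∈ Finset.range (n + 1),
      (-1) ^ (k + 1) * (n.choose (k + 1) : F) * f (k + 1) + f 0 := by
    rw [Finset.sum_range_succ]
    simp [altSum, Finset.sum_range_succ' _ n]
  rw [h1, altSum, Finset.sum_range_succ', altSum]
  have h2 : ∀ k, (-1) ^ (k + 1) * ((n + 1).choose (k + 1) : F) * f (k + 1) =
      (-1) ^ (k + 1) * (n.choose (k + 1) : F) * f (k + 1) -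
        (-1) ^ k * (n.choose k : F) * f (k + 1) := fun k => by
    rw [Nat.choose_succ_succ]; push_cast; ring
  simp only [h2, Finset.sum_sub_distrib]
  simp
  ring

theorem altSum_shift {F : Type*} [CommRing F] (n : ℕ) (f : ℕ → F) :
    altSum n (fun k => f (k + 1)) = altSum n f - altSum (n + 1) f := by
  rw [altSum_succ]; ring

theorem altSum_succ_natCast_mul {F : Type*} [CommRing F] (n : ℕ) (f : ℕ → F) :
    altSum (n + 1) (fun k => (k : F) * f k) =
      ((n : F) + 1) * (altSum (n + 1) f - altSum n f) := by
  induction n generalizing f with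
  | zero => simp [altSum_succ, altSum_zero]
  | succ n ih =>
    rw [altSum_succ, ih]
    have : (fun k : ℕ => ((k + 1 : ℕ) : F) * f (k + 1)) =
        fun k : ℕ => (k : F) * f (k + 1) + f (k + 1) := by
      funext k; push_cast; ring
    rw [this, altSum_add, ih (fun k => f (k + 1)), altSum_shift, altSum_shift]
    push_cast; ring

theorem altSum_natCast_mul {F : Type*} [CommRing F] (n : ℕ) (f : ℕ → F) :
    altSum n (fun k => (k : F) * f k) = (n : F) * (altSum n f - altSum (n - 1) f) := by
  cases n with
  | zero => simp [altSum_zero]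
  | succ n => rw [altSum_succ_natCast_mul]; simp

theorem altSum_one {F : Type*} [CommRing F] (n : ℕ) :
    altSum (n + 1) (fun _ => (1 : F)) = 0 := by
  rw [altSum_succ, sub_self]

/-- The action of multiplication by the variable on sequences of normalized factorial moments. -/
def mulOp {F : Type*} [Field F] (v : F) (f : ℕ → F) (k : ℕ) : F :=
  (v - ((k : F) + 1 / 2) ^ 2) * f (k + 1) + (k : F) ^ 2 * f k

/-- On the sequence of alternating sums, `mulOp` acts tridiagonally: this is the three-term
recurrence of the orthogonal polynomials. At `n = 0` the truncated `n - 1` is harmless because of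
the factor `n²`. -/
theorem altSum_mulOp {F : Type*} [Field F] [CharZero F] (v : F) (n : ℕ) (f : ℕ → F) :
    altSum n (mulOp v f) =
      (((n : F) + 1 / 2) ^ 2 - v) * (altSum (n + 1) f - altSum n f) -
        (n : F) ^ 2 * (altSum n f - altSum (n - 1) f) := by
  have h : mulOp v f = fun k : ℕ =>
      ((v - 1 / 4) * f (k + 1) + (-1) * (fun k : ℕ => (k : F) * ((k : F) * f k)) (k + 1 : ℕ) +
        (fun k : ℕ => (k : F) * f k) (k + 1 : ℕ)) + (k : F) * ((k : F) * f k) := by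
    funext k; simp only [mulOp]; push_cast; ring
  rw [h]
  simp only [altSum_add, altSum_const_mul]
  rw [altSum_shift, altSum_shift n (fun k : ℕ => (k : F) * ((k : F) * f k)),
    altSum_shift n (fun k : ℕ => (k : F) * f k)]
  cases n with
  | zero => simp [altSum_succ, altSum_zero]; ring
  | succ n =>
    simp only [altSum_succ_natCast_mul, altSum_natCast_mul n, Nat.add_sub_cancel]
    push_cast
    ring

/-- The constant sequence has alternating sums `1, 0, 0, …`. Each tridiagonal step extends the
support by one place, and the new top entry picks up the factor `(i+1)²`. -/
theorem altSum_mulOp_iterate {F : Type*} [Field F] [CharZero F] (v : F) (i : ℕ) :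
    (∀ n, i < n → altSum n ((mulOp v)^[i] fun _ => 1) = 0) ∧
      altSum i ((mulOp v)^[i] fun _ => 1) = (i.factorial : F) ^ 2 := by
  induction i with
  | zero =>
    refine ⟨fun n hn => ?_, by simp [altSum_zero]⟩
    obtain ⟨n, rfl⟩ := Nat.exists_eq_succ_of_ne_zero hn.ne'
    exact altSum_one n
  | succ i ih =>
    rw [Function.iterate_succ_apply']
    refine ⟨fun n hn => ?_, ?_⟩
    · rw [altSum_mulOp, ih.1 _ (by omega), ih.1 _ (by omega), ih.1 _ (by omega)]; ring
    · rw [altSum_mulOp, ih.1 _ (by omega), ih.1 _ (by omega), Nat.add_sub_cancel, ih.2,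
        Nat.factorial_succ]
      push_cast; ring

/-! ### Moment functionals and orthogonal polynomials. -/

/-- `∏_{j<k} (v - (j + 1/2)²)`. -/
def halfProd {F : Type*} [Field F] (v : F) (k : ℕ) : F :=
  ∏ j ∈ Finset.range k, (v - ((j : F) + 1 / 2) ^ 2)

theorem halfProd_succ {F : Type*} [Field F] (v : F) (k : ℕ) :
    halfProd v (k + 1) = halfProd v k * (v - ((k : F) + 1 / 2) ^ 2) :=
  Finset.prod_range_succ _ _

/-- `∏_{j<k} (X - j²)`. -/
noncomputable def sqFactorial (F : Type*) [Field F] (k : ℕ) : F[X] :=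
  ∏ j ∈ Finset.range k, (X - C ((j : F) ^ 2))

theorem sqFactorial_succ (F : Type*) [Field F] (k : ℕ) :
    sqFactorial F (k + 1) = sqFactorial F k * (X - C ((k : F) ^ 2)) :=
  Finset.prod_range_succ _ _

theorem sqFactorial_monic (F : Type*) [Field F] (k : ℕ) : (sqFactorial F k).Monic :=
  monic_prod_of_monic _ _ fun _ _ => monic_X_sub_C _

theorem natDegree_sqFactorial (F : Type*) [Field F] (k : ℕ) :
    (sqFactorial F k).natDegree = k := by
  rw [sqFactorial, natDegree_prod_of_monic _ _ fun _ _ => monic_X_sub_C _,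
    Finset.sum_congr rfl fun j _ => natDegree_X_sub_C _]
  simp

/-- The linear functional on polynomials with moments `c`. -/
noncomputable def momentFunctional {F : Type*} [Field F] (c : ℕ → F) : F[X] →ₗ[F] F :=
  (Polynomial.basisMonomials F).constr F c

theorem momentFunctional_X_pow {F : Type*} [Field F] (c : ℕ → F) (k : ℕ) :
    momentFunctional c (X ^ k) = c k := by
  have := (Polynomial.basisMonomials F).constr_basis F c k
  simp only [coe_basisMonomials, monomial_one_right_eq_X_pow] at this
  exact this

theorem momentFunctional_X_pow_mul {F : Type*} [Field F] (c : ℕ → F) (i : ℕ) {n : ℕ} {p : F[X]}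
    (hp : p.natDegree ≤ n) :
    momentFunctional c (X ^ i * p) = ∑ j ∈ Finset.range (n + 1), c (i + j) * p.coeff j := by
  conv_lhs => rw [p.as_sum_range_C_mul_X_pow' (Nat.lt_succ_of_le hp)]
  rw [Finset.mul_sum, map_sum]
  refine Finset.sum_congr rfl fun j _ => ?_
  rw [mul_left_comm, ← pow_add, ← smul_eq_C_mul, map_smul, momentFunctional_X_pow, smul_eq_mul,
    mul_comm]

theorem momentFunctional_X_mul {F : Type*} [Field F] (b : ℕ → F) (p : F[X]) :
    momentFunctional b (X * p) = momentFunctional (fun k => b (k + 1)) p := by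
  have h1 := momentFunctional_X_pow_mul b 1 le_rfl (p := p)
  have h2 := momentFunctional_X_pow_mul (fun k => b (k + 1)) 0 le_rfl (p := p)
  rw [pow_one] at h1
  rw [pow_zero, one_mul] at h2
  rw [h1, h2]
  simp only [zero_add, add_comm 1]

/-- From `X s_k = s_{k+1} + k² s_k`: after division by `halfProd v k`, multiplication by `X` becomes
`mulOp`. -/
theorem momentFunctional_X_pow_mul_sqFactorial {F : Type*} [Field F] {c : ℕ → F} {v : F}
    (h : ∀ k, momentFunctional c (sqFactorial F k) = halfProd v k) (i k : ℕ) :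
    momentFunctional c (X ^ i * sqFactorial F k) =
      halfProd v k * (mulOp v)^[i] (fun _ => 1) k := by
  induction i generalizing k with
  | zero => simp [h]
  | succ i ih =>
    have : X ^ (i + 1) * sqFactorial F k =
        X ^ i * sqFactorial F (k + 1) + ((k : F) ^ 2) • (X ^ i * sqFactorial F k) := by
      rw [sqFactorial_succ, smul_eq_C_mul]; ring
    rw [this, map_add, map_smul, ih, ih, Function.iterate_succ_apply', halfProd_succ, mulOp,
      smul_eq_mul]
    ring

/-- The orthogonal polynomial of degree `n`, normalized to have value `1` at `0`. -/
noncomputable def orthPoly {F : Type*} [Field F] (v : F) (n : ℕ) : F[X] :=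
  ∑ k ∈ Finset.range (n + 1), ((-1) ^ k * (n.choose k : F) * (halfProd v k)⁻¹) • sqFactorial F k

theorem natDegree_orthPoly_le {F : Type*} [Field F] (v : F) (n : ℕ) :
    (orthPoly v n).natDegree ≤ n :=
  natDegree_sum_le_of_forall_le _ _ fun k hk =>
    (natDegree_smul_le _ _).trans (by
      rw [natDegree_sqFactorial]; simpa [Nat.lt_succ_iff] using hk)

theorem coeff_orthPoly {F : Type*} [Field F] (v : F) (n : ℕ) :
    (orthPoly v n).coeff n = (-1) ^ n * (halfProd v n)⁻¹ := by
  rw [orthPoly, finsetSum_coeff, Finset.sum_range_succ, Finset.sum_eq_zero]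
  · have := (sqFactorial_monic F n).coeff_natDegree
    rw [natDegree_sqFactorial] at this
    simp [this]
  · intro k hk
    rw [coeff_smul, coeff_eq_zero_of_natDegree_lt, smul_zero]
    rw [natDegree_sqFactorial]; exact Finset.mem_range.1 hk

theorem map_mul_orthPoly {F : Type*} [Field F] {v : F} {n : ℕ} (hv : ∀ k ≤ n, halfProd v k ≠ 0)
    (L : F[X] →ₗ[F] F) (q : F[X]) {f : ℕ → F}
    (hf : ∀ k, L (q * sqFactorial F k) = halfProd v k * f k) :
    L (q * orthPoly v n) = altSum n f := by
  rw [orthPoly, Finset.mul_sum, map_sum, altSum]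
  refine Finset.sum_congr rfl fun k hk => ?_
  have := hv k (by simpa [Nat.lt_succ_iff] using hk)
  rw [mul_smul_comm, map_smul, hf, smul_eq_mul]
  field_simp

/-! ### The ratio of the two Hankel determinants. -/

/-- Cramer's rule without division: apply the adjugate to both sides and read off the last
coordinate. -/
theorem mul_det_of_mulVec_eq_single {R : Type*} [CommRing R] {n : ℕ}
    (M : Matrix (Fin (n + 1)) (Fin (n + 1)) R) (w : Fin (n + 1) → R) (r : Fin (n + 1)) (q : R)
    (h : M.mulVec w = Pi.single r q) :
    w (Fin.last n) * M.det =
      (-1) ^ ((r : ℕ) + n) * q * (M.submatrix r.succAbove Fin.castSucc).det := by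
  have h1 : M.adjugate.mulVec (M.mulVec w) = M.det • w := by
    rw [Matrix.mulVec_mulVec, Matrix.adjugate_mul, Matrix.smul_mulVec, Matrix.one_mulVec]
  have h2 := congrFun h1 (Fin.last n)
  rw [h, Matrix.mulVec_single, Pi.smul_apply, Pi.smul_apply, smul_eq_mul] at h2
  rw [mul_comm, ← h2]
  simp [Matrix.adjugate_fin_succ_eq_det_submatrix]
  ring

theorem hankel_mulVec_coeff {F : Type*} [Field F] (c : ℕ → F) {n : ℕ} {p : F[X]}
    (hp : p.natDegree ≤ n) (i : Fin (n + 1)) :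
    (Matrix.of fun i j : Fin (n + 1) => c ((i : ℕ) + (j : ℕ))).mulVec
      (fun j => p.coeff (j : ℕ)) i = momentFunctional c (X ^ (i : ℕ) * p) := by
  rw [momentFunctional_X_pow_mul c i hp, Finset.sum_range]
  rfl

theorem hankelDet_shift {F : Type*} [Field F] [CharZero F] {b : ℕ → F} {v : F} {n : ℕ}
    (hn : 1 ≤ n) (hb : b 0 = 0) (hv : ∀ j < n, v - ((j : F) + 1 / 2) ^ 2 ≠ 0)
    (h : ∀ k, momentFunctional (fun k => b (k + 1)) (sqFactorial F k) = halfProd v k) :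
    hankelDet n b = (-1) ^ (n - 1) * (1 / ((n.factorial : F) ^ 2 * (v - 1 / 4))) *
      (∑ j ∈ Finset.range n, ∏ i ∈ Finset.Icc 1 j,
        (i : F) ^ 2 / (((i : F) + 1 / 2) ^ 2 - v)) * hankelDet n (fun k => b (k + 1)) := by
  obtain ⟨n, rfl⟩ := Nat.exists_eq_succ_of_ne_zero (by omega : n ≠ 0)
  simp only [Nat.succ_eq_add_one, Nat.add_sub_cancel] at *
  set N := n + 1 with hN
  have hm : ∀ k ≤ N, halfProd v k ≠ 0 := fun k hk =>
    Finset.prod_ne_zero_iff.2 fun j hj => hv j (lt_of_lt_of_le (Finset.mem_range.1 hj) hk)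
  set c : ℕ → F := fun k => b (k + 1) with hc
  have horth : ∀ i, momentFunctional c (X ^ i * orthPoly v N) =
      altSum N ((mulOp v)^[i] fun _ => 1) := fun i =>
    map_mul_orthPoly hm _ _ (momentFunctional_X_pow_mul_sqFactorial h i)
  have hdeg := natDegree_orthPoly_le v N
  -- the Hankel matrix of `c`
  have hC := mul_det_of_mulVec_eq_single
    (Matrix.of fun i j : Fin (N + 1) => c ((i : ℕ) + (j : ℕ)))
    (fun j => (orthPoly v N).coeff (j : ℕ)) (Fin.last N) ((N.factorial : F) ^ 2) (by
      funext i
      rw [hankel_mulVec_coeff c hdeg, horth]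
      rcases Fin.eq_castSucc_or_eq_last i with ⟨i, rfl⟩ | rfl
      · rw [Pi.single_eq_of_ne (Fin.castSucc_lt_last i).ne]
        exact (altSum_mulOp_iterate v _).1 _ i.2
      · rw [Pi.single_eq_same]
        exact (altSum_mulOp_iterate v N).2)
  -- the Hankel matrix of `b`
  set g : ℕ → F := fun k => momentFunctional b (sqFactorial F k) / halfProd v k with hg
  have hB := mul_det_of_mulVec_eq_single
    (Matrix.of fun i j : Fin (N + 1) => b ((i : ℕ) + (j : ℕ)))
    (fun j => (orthPoly v N).coeff (j : ℕ)) 0 (altSum N g) (by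
      funext i
      rw [hankel_mulVec_coeff b hdeg]
      refine Fin.cases ?_ (fun i => ?_) i
      · rw [Pi.single_eq_same, orthPoly, Fin.val_zero, pow_zero, one_mul, map_sum, altSum]
        refine Finset.sum_congr rfl fun k _ => ?_
        rw [map_smul, smul_eq_mul, hg]
        ring
      · rw [Pi.single_eq_of_ne (Fin.succ_ne_zero i), Fin.val_succ, pow_succ', mul_assoc,
          momentFunctional_X_mul, horth]
        exact (altSum_mulOp_iterate v _).1 _ i.2)
  -- Since `c` is `b` shifted by one, dropping the last row for `c` or row `0` for `b` leaves the
  -- same rows.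
  have hminor : (Matrix.of fun i j : Fin (N + 1) => c ((i : ℕ) + (j : ℕ))).submatrix
        (Fin.last N).succAbove Fin.castSucc =
      (Matrix.of fun i j : Fin (N + 1) => b ((i : ℕ) + (j : ℕ))).submatrix
        (0 : Fin (N + 1)).succAbove Fin.castSucc := by
    ext i j
    simp [hc, add_right_comm]
  -- the sum in row `0`
  have hg0 : g 0 = 0 := by
    have := momentFunctional_X_pow b 0
    rw [pow_zero] at this
    simp [hg, sqFactorial, this, hb]
  -- This is `B(X s_k) = L(s_k)` after normalization; `k < N` keeps `halfProd v (k + 1)` nonzero.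
  have hgop : ∀ k < N, mulOp v g k = 1 := fun k hk => by
    have h1 : X * sqFactorial F k = sqFactorial F (k + 1) + ((k : F) ^ 2) • sqFactorial F k := by
      rw [sqFactorial_succ, smul_eq_C_mul]; ring
    have h2 := momentFunctional_X_mul b (sqFactorial F k)
    rw [h1, map_add, map_smul, h, smul_eq_mul] at h2
    have h3 := hm k hk.le
    have h4 := hv k hk
    simp only [mulOp, hg, halfProd_succ]
    rw [← mul_div_assoc, mul_comm (halfProd v k), mul_div_mul_left _ _ h4, ← mul_div_assoc,
      ← add_div, h2, div_self h3]
  -- The alternating sums of `mulOp v g = 1` vanish beyond index `0`, so `altSum_mulOp` gives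
  -- `((j+1/2)² - v) d_j = j² d_{j-1}` for the increments `d_j`; index `0` gives the initial value.
  have hdiff : ∀ j < N, altSum (j + 1) g - altSum j g =
      -(1 / (v - 1 / 4)) * ∏ i ∈ Finset.Icc 1 j, (i : F) ^ 2 / (((i : F) + 1 / 2) ^ 2 - v) := by
    intro j
    induction j with
    | zero =>
      intro hj
      have h1 := altSum_mulOp v 0 g
      rw [altSum_zero (mulOp v g), hgop 0 hj] at h1
      have h2 := hv 0 hj
      have h3 : v - 1 / 4 ≠ 0 := by
        intro h3; apply h2; rw [← h3]; push_cast; ring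
      simp only [Finset.Icc_eq_empty (by omega : ¬ 1 ≤ 0), Finset.prod_empty]
      rw [mul_one, ← one_div_neg_eq_neg_one_div, eq_div_iff (neg_ne_zero.2 h3)]
      push_cast at h1
      linear_combination -h1
    | succ j ih =>
      intro hj
      have h1 := altSum_mulOp v (j + 1) g
      rw [altSum_congr (g := fun _ => 1) fun k hk => hgop k (by omega), altSum_one,
        Nat.add_sub_cancel, ih (by omega)] at h1
      have h2 := hv (j + 1) hj
      have h3 : (((j + 1 : ℕ) : F) + 1 / 2) ^ 2 - v ≠ 0 := by
        intro h3; apply h2; linear_combination -h3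
      rw [Finset.prod_Icc_succ_top (by omega), ← mul_assoc, mul_div_assoc', eq_div_iff h3]
      linear_combination -h1
  have hsum : altSum N g = -(1 / (v - 1 / 4)) * ∑ j ∈ Finset.range N,
      ∏ i ∈ Finset.Icc 1 j, (i : F) ^ 2 / (((i : F) + 1 / 2) ^ 2 - v) := by
    rw [Finset.mul_sum, ← Finset.sum_congr rfl fun j hj => hdiff j (Finset.mem_range.1 hj),
      Finset.sum_range_sub (fun j => altSum j g), altSum_zero, hg0, sub_zero]
  rw [hminor] at hC
  have hw : (orthPoly v N).coeff N ≠ 0 := by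
    rw [coeff_orthPoly]
    exact mul_ne_zero (pow_ne_zero _ (by simp)) (inv_ne_zero (hm N le_rfl))
  have hfac : (N.factorial : F) ≠ 0 := Nat.cast_ne_zero.2 N.factorial_ne_zero
  rw [hsum] at hB
  simp only [Fin.val_last, Fin.val_zero, zero_add] at hB hC
  rw [← two_mul, pow_mul, neg_one_sq, one_pow, one_mul] at hC
  have h14 : v - 1 / 4 ≠ 0 := by
    intro h3; apply hv 0 (by omega); rw [← h3]; push_cast; ring
  apply mul_left_cancel₀ hw
  rw [hankelDet, hankelDet, hB, pow_succ (-1 : F) n]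
  conv_rhs => rw [mul_left_comm, hC]
  generalize ∑ j ∈ Finset.range N, ∏ i ∈ Finset.Icc 1 j,
    (i : F) ^ 2 / (((i : F) + 1 / 2) ^ 2 - v) = S
  field_simp

/-! ### Euler polynomials and their factorial moments. -/

theorem constantCoeff_exp_add_one_ne_zero :
    PowerSeries.constantCoeff (PowerSeries.exp ℚ + 1) ≠ 0 := by
  rw [map_add, PowerSeries.constantCoeff_exp, map_one]; norm_num

/-- Compare coefficients in `G e^t + G = 2 e^{Xt}`. -/
theorem eulerPoly_add_eulerPoly (m : ℕ) :
    ∑ j ∈ Finset.range (m + 1), (m.choose j : ℚ[X]) * eulerPoly j + eulerPoly m = 2 * X ^ m := by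
  set G : PowerSeries ℚ[X] :=
    PowerSeries.map (C : ℚ →+* ℚ[X]) (2 * (PowerSeries.exp ℚ + 1)⁻¹) *
      PowerSeries.rescale (X : ℚ[X]) (PowerSeries.exp ℚ[X]) with hG
  have hE : ∀ j, eulerPoly j = (j.factorial : ℚ[X]) * PowerSeries.coeff j G := fun j => rfl
  have h : G * PowerSeries.exp ℚ[X] + G =
      PowerSeries.rescale (X : ℚ[X]) (PowerSeries.exp ℚ[X]) +
        PowerSeries.rescale (X : ℚ[X]) (PowerSeries.exp ℚ[X]) := by
    have h1 := congrArg (PowerSeries.map (C : ℚ →+* ℚ[X]))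
      (PowerSeries.inv_mul_cancel _ constantCoeff_exp_add_one_ne_zero)
    rw [map_mul, map_add, map_one, PowerSeries.map_exp] at h1
    rw [hG, map_mul, map_ofNat]
    linear_combination 2 * PowerSeries.rescale (X : ℚ[X]) (PowerSeries.exp ℚ[X]) * h1
  have h2 := congrArg (fun S => (m.factorial : ℚ[X]) * PowerSeries.coeff m S) h
  simp only [map_add, PowerSeries.coeff_mul, PowerSeries.coeff_rescale, PowerSeries.coeff_exp,
    mul_add, ← hE] at h2
  rw [Finset.Nat.sum_antidiagonal_eq_sum_range_succ_mk, Finset.mul_sum] at h2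
  have hfac : ∀ j : ℕ, (j.factorial : ℚ) ≠ 0 := fun j => Nat.cast_ne_zero.2 j.factorial_ne_zero
  have h3 : (m.factorial : ℚ[X]) * algebraMap ℚ ℚ[X] (1 / m.factorial) = 1 := by
    rw [← map_natCast (algebraMap ℚ ℚ[X]), ← map_mul, mul_one_div_cancel (hfac m), map_one]
  have h4 : ∀ j ∈ Finset.range m.succ, (m.factorial : ℚ[X]) *
      (PowerSeries.coeff j G * algebraMap ℚ ℚ[X] (1 / (m - j).factorial)) =
        (m.choose j : ℚ[X]) * eulerPoly j := by
    intro j hj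
    have hj : j ≤ m := Nat.lt_succ_iff.1 (Finset.mem_range.1 hj)
    have h5 : (m.factorial : ℚ[X]) * algebraMap ℚ ℚ[X] (1 / (m - j).factorial) =
        (m.choose j : ℚ[X]) * (j.factorial : ℚ[X]) := by
      rw [← map_natCast (algebraMap ℚ ℚ[X]) m.factorial, ← map_mul,
        ← Nat.choose_mul_factorial_mul_factorial hj]
      rw [Nat.cast_mul, mul_assoc, mul_one_div_cancel (hfac _), mul_one, Nat.cast_mul, map_mul,
        map_natCast, map_natCast]
    rw [hE]
    linear_combination PowerSeries.coeff j G * h5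
  rw [Finset.sum_congr rfl h4] at h2
  linear_combination h2 + 2 * X ^ m * h3

/-- Replacing `t` by `2t` at `x = 1/2` gives `2 e^t / (e^{2t} + 1) = 2 / (e^t + e^{-t})`. -/
theorem eulerNumber_eq (m : ℕ) :
    eulerNumber m = 2 ^ m * (eulerPoly m).eval (1 / 2) := by
  have h : 2 * (PowerSeries.exp ℚ + PowerSeries.rescale (-1 : ℚ) (PowerSeries.exp ℚ))⁻¹ =
      PowerSeries.rescale (2 : ℚ) (PowerSeries.map (evalRingHom (1 / 2 : ℚ))
        (PowerSeries.map (C : ℚ →+* ℚ[X]) (2 * (PowerSeries.exp ℚ + 1)⁻¹) *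
          PowerSeries.rescale (X : ℚ[X]) (PowerSeries.exp ℚ[X]))) := by
    have h0 : PowerSeries.constantCoeff
        (PowerSeries.exp ℚ + PowerSeries.rescale (-1 : ℚ) (PowerSeries.exp ℚ)) ≠ 0 := by
      rw [map_add, PowerSeries.constantCoeff_exp, ← PowerSeries.coeff_zero_eq_constantCoeff_apply,
        PowerSeries.coeff_rescale, PowerSeries.coeff_zero_eq_constantCoeff_apply,
        PowerSeries.constantCoeff_exp]
      norm_num
    have h1 : PowerSeries.map (evalRingHom (1 / 2 : ℚ))
        (PowerSeries.map (C : ℚ →+* ℚ[X]) (2 * (PowerSeries.exp ℚ + 1)⁻¹)) =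
          2 * (PowerSeries.exp ℚ + 1)⁻¹ := by
      ext k; simp only [PowerSeries.coeff_map, coe_evalRingHom, eval_C]
    have h2 : PowerSeries.rescale (2 : ℚ) (PowerSeries.map (evalRingHom (1 / 2 : ℚ))
        (PowerSeries.rescale (X : ℚ[X]) (PowerSeries.exp ℚ[X]))) = PowerSeries.exp ℚ := by
      ext k
      simp [PowerSeries.coeff_map, PowerSeries.coeff_rescale, PowerSeries.coeff_exp]
      field_simp
    have h3 := congrArg (PowerSeries.rescale (2 : ℚ))
      (PowerSeries.inv_mul_cancel _ constantCoeff_exp_add_one_ne_zero)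
    have h4 := PowerSeries.exp_pow_eq_rescale_exp (A := ℚ) 2
    have h5 := PowerSeries.exp_mul_exp_neg_eq_one (A := ℚ)
    rw [PowerSeries.evalNegHom] at h5
    rw [map_mul, map_add, map_one, ← Nat.cast_ofNat, ← h4, Nat.cast_ofNat] at h3
    rw [eq_comm, PowerSeries.eq_mul_inv_iff_mul_eq h0, map_mul, map_mul, h1, h2, map_mul,
      map_ofNat]
    linear_combination 2 * h3 + 2 * PowerSeries.rescale (2 : ℚ) (PowerSeries.exp ℚ + 1)⁻¹ * h5
  rw [eulerNumber, h, PowerSeries.coeff_rescale, PowerSeries.coeff_map, eulerPoly, eval_mul,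
    eval_natCast, coe_evalRingHom]
  ring

theorem momentFunctional_comp_X_add_one {F : Type*} [Field F] [Algebra ℚ F] (z : F) (f : F[X]) :
    momentFunctional (fun m => aeval z (eulerPoly m)) (f.comp (X + 1) + f) = 2 * f.eval z := by
  induction f using Polynomial.induction_on' with
  | add p q hp hq =>
    rw [add_comp, add_add_add_comm, map_add, hp, hq, eval_add, mul_add]
  | monomial m a =>
    have h := congrArg (aeval z) (eulerPoly_add_eulerPoly m)
    simp only [map_add, map_sum, map_mul, map_pow, map_natCast, map_ofNat, aeval_X] at h
    rw [← smul_X_eq_monomial, smul_comp, ← smul_add, map_smul, map_add, X_pow_comp, add_pow,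
      map_sum, momentFunctional_X_pow, eval_smul, eval_pow, eval_X, smul_eq_mul, smul_eq_mul,
      mul_left_comm, ← h]
    congr 2
    refine Finset.sum_congr rfl fun j _ => ?_
    rw [one_pow, mul_one, mul_comm, ← C_eq_natCast, ← smul_eq_C_mul, map_smul,
      momentFunctional_X_pow, smul_eq_mul]

theorem momentFunctional_even {F : Type*} [Field F] (c : ℕ → F) (p : F[X]) :
    momentFunctional (fun k => c (2 * k)) p = momentFunctional c (p.comp (X ^ 2)) := by
  induction p using Polynomial.induction_on' with
  | add p q hp hq => rw [add_comp, map_add, map_add, hp, hq]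
  | monomial m a =>
    rw [← smul_X_eq_monomial, smul_comp, map_smul, map_smul, X_pow_comp, ← pow_mul,
      momentFunctional_X_pow, momentFunctional_X_pow]

/-- Inverts `f ↦ f(X+1) + f(X)` on `2 s_k(X²)`, so that the Euler functional is evaluated on
`s_k(X²)` as `f` at a point. -/
theorem sqFactorial_comp_eq {F : Type*} [Field F] (k : ℕ) :
    (∏ j ∈ Finset.range k, (X - C ((j : F) + 1)) * (X + C (j : F))).comp (X + 1) +
      ∏ j ∈ Finset.range k, (X - C ((j : F) + 1)) * (X + C (j : F)) =
      2 * (sqFactorial F k).comp (X ^ 2) := by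
  -- Up to the factor `X`, the two terms are `s_k(X²)` times `X + k` and `X - k`, which add up to
  -- `2X`.
  have key : ∀ k : ℕ,
      (∏ j ∈ Finset.range k, (X - C ((j : F) + 1)) * (X + C (j : F))).comp (X + 1) * X =
        (sqFactorial F k).comp (X ^ 2) * (X + C (k : F)) ∧
      (∏ j ∈ Finset.range k, (X - C ((j : F) + 1)) * (X + C (j : F))) * X =
        (sqFactorial F k).comp (X ^ 2) * (X - C (k : F)) := by
    intro k
    induction k with
    | zero => simp [sqFactorial]
    | succ k ih =>
      rw [Finset.prod_range_succ, sqFactorial_succ]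
      simp only [mul_comp, sub_comp, add_comp, X_comp, C_comp]
      constructor
      · rw [mul_right_comm, ih.1]
        simp only [map_add, map_pow, map_natCast, map_one, Nat.cast_succ]
        ring
      · rw [mul_right_comm, ih.2]
        simp only [map_add, map_pow, map_natCast, map_one, Nat.cast_succ]
        ring
  apply mul_right_cancel₀ (X_ne_zero : (X : F[X]) ≠ 0)
  rw [add_mul, (key k).1, (key k).2]
  ring

theorem aeval_eulerPolyHalf {F : Type*} [Field F] [Algebra ℚ F] (x : F) (m : ℕ) :
    aeval x (eulerPolyHalf m) = aeval ((x + 1) / 2) (eulerPoly m) := by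
  rw [eulerPolyHalf, aeval_comp]
  congr 1
  simp [div_eq_inv_mul]

theorem momentFunctional_eulerPolyHalf {F : Type*} [Field F] [Algebra ℚ F] (x : F) (k : ℕ) :
    momentFunctional (fun k => aeval x (eulerPolyHalf (2 * k))) (sqFactorial F k) =
      halfProd (x ^ 2 / 4) k := by
  have : CharZero F := algebraRat.charZero F
  simp only [aeval_eulerPolyHalf]
  rw [momentFunctional_even (fun m => aeval ((x + 1) / 2) (eulerPoly m))]
  have h := momentFunctional_comp_X_add_one ((x + 1) / 2)
    (∏ j ∈ Finset.range k, (X - C ((j : F) + 1)) * (X + C (j : F)))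
  rw [sqFactorial_comp_eq, ← C_ofNat, ← smul_eq_C_mul, map_smul, smul_eq_mul] at h
  rw [mul_left_cancel₀ two_ne_zero h, eval_prod, halfProd]
  refine Finset.prod_congr rfl fun j _ => ?_
  simp
  ring

/-! ### Matching `curlyK`, and specialization. -/

theorem curlyK_eq_sum_range {F : Type*} [Field F] (x : F) {n : ℕ} (hn : 1 ≤ n) :
    curlyK n x = ∑ j ∈ Finset.range n, ∏ i ∈ Finset.Icc 1 j,
      (2 * (i : F)) ^ 2 / ((2 * (i : F) + 1) ^ 2 - x ^ 2) := by
  have h : Finset.range n = insert 0 (Finset.Icc 1 (n - 1)) := by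
    ext j; simp; omega
  rw [h, Finset.sum_insert (by simp)]
  simp [curlyK]

theorem sum_prod_eq_curlyK {F : Type*} [Field F] [CharZero F] (x : F) {n : ℕ} (hn : 1 ≤ n) :
    ∑ j ∈ Finset.range n, ∏ i ∈ Finset.Icc 1 j,
      (i : F) ^ 2 / (((i : F) + 1 / 2) ^ 2 - x ^ 2 / 4) = curlyK n x := by
  rw [curlyK_eq_sum_range x hn]
  refine Finset.sum_congr rfl fun j _ => Finset.prod_congr rfl fun i _ => ?_
  rw [show (2 * (i : F)) ^ 2 = 4 * (i : F) ^ 2 by ring,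
    show (2 * (i : F) + 1) ^ 2 - x ^ 2 = 4 * (((i : F) + 1 / 2) ^ 2 - x ^ 2 / 4) by ring,
    mul_div_mul_left _ _ (by norm_num)]

theorem hankelDet_aeval_shiftedEulerPoly {F : Type*} [Field F] [Algebra ℚ F] (x : F) {n : ℕ}
    (hn : 1 ≤ n) (hx : ∀ l ∈ Finset.Icc 1 n, x ^ 2 ≠ (2 * (l : F) - 1) ^ 2) :
    hankelDet n (fun k => aeval x (shiftedEulerPoly k)) =
      (-1) ^ (n - 1) * (4 / ((n.factorial : F) ^ 2 * (x ^ 2 - 1))) *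
        curlyK n x * hankelDet n (fun k => aeval x (eulerPolyHalf (2 * k))) := by
  have : CharZero F := algebraRat.charZero F
  have h := hankelDet_shift (b := fun k => aeval x (shiftedEulerPoly k)) (v := x ^ 2 / 4) hn
    (by simp [shiftedEulerPoly]) (fun j hj h => hx (j + 1) (by simp; omega) (by
      push_cast
      linear_combination 4 * h))
    (momentFunctional_eulerPolyHalf x)
  rw [sum_prod_eq_curlyK x hn, show x ^ 2 / 4 - 1 / 4 = (x ^ 2 - 1) / 4 by ring,
    mul_div_assoc' ((n.factorial : F) ^ 2), one_div_div] at h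
  exact h

theorem map_hankelDet {R S : Type*} [CommRing R] [CommRing S] (f : R →+* S) (n : ℕ) (c : ℕ → R) :
    f (hankelDet n c) = hankelDet n (fun k => f (c k)) := by
  rw [hankelDet, RingHom.map_det]
  rfl

theorem hankelDet_mul_pow {R : Type*} [CommRing R] (n : ℕ) (a : R) (c : ℕ → R) :
    hankelDet n (fun k => a ^ k * c k) = a ^ (n * (n + 1)) * hankelDet n c := by
  have h : (Matrix.of fun i j : Fin (n + 1) => a ^ ((i : ℕ) + j) * c ((i : ℕ) + (j : ℕ))) =
      Matrix.diagonal (fun i : Fin (n + 1) => a ^ (i : ℕ)) *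
        (Matrix.of fun i j : Fin (n + 1) => c ((i : ℕ) + (j : ℕ))) *
        Matrix.diagonal (fun i : Fin (n + 1) => a ^ (i : ℕ)) := by
    ext i j
    simp [pow_add]
    ring
  rw [hankelDet, h, Matrix.det_mul, Matrix.det_mul, Matrix.det_diagonal, hankelDet,
    Finset.prod_pow_eq_pow_sum, Fin.sum_univ_eq_sum_range (fun i => i),
    mul_right_comm, ← pow_add, ← mul_two, Finset.sum_range_id_mul_two, Nat.add_sub_cancel,
    mul_comm (n + 1)]

theorem hankelDet_const_mul {R : Type*} [CommRing R] (n : ℕ) (a : R) (c : ℕ → R) :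
    hankelDet n (fun k => a * c k) = a ^ (n + 1) * hankelDet n c := by
  have := Matrix.det_smul (Matrix.of fun i j : Fin (n + 1) => c ((i : ℕ) + (j : ℕ))) a
  rw [Fintype.card_fin] at this
  exact this

theorem prod_two_mul_sq_div (j : ℕ) :
    ∏ i ∈ Finset.Icc 1 j, (2 * (i : ℚ)) ^ 2 / ((2 * (i : ℚ) + 1) ^ 2 - 0 ^ 2) =
      (16 : ℚ) ^ j / ((2 * (j : ℚ) + 1) ^ 2 * ((2 * j).choose j : ℚ) ^ 2) := by
  induction j with
  | zero => simp
  | succ j ih =>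
    rw [Finset.prod_Icc_succ_top (by omega), ih]
    have h := Nat.succ_mul_centralBinom_succ j
    rw [Nat.centralBinom, Nat.centralBinom] at h
    have h' : ((j : ℚ) + 1) * ((2 * (j + 1)).choose (j + 1) : ℚ) =
        2 * (2 * j + 1) * ((2 * j).choose j : ℚ) := by exact_mod_cast h
    have h1 : ((2 * j).choose j : ℚ) ≠ 0 :=
      Nat.cast_ne_zero.2 (Nat.choose_pos (by omega)).ne'
    have h2 : ((2 * (j + 1)).choose (j + 1) : ℚ) ≠ 0 :=
      Nat.cast_ne_zero.2 (Nat.choose_pos (by omega)).ne'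
    have h3 : (2 * (j : ℚ) + 1) ≠ 0 := by positivity
    have h4 : (j : ℚ) + 1 ≠ 0 := by positivity
    have h5 : ((2 * (j + 1)).choose (j + 1) : ℚ) =
        2 * (2 * j + 1) * ((2 * j).choose j : ℚ) / (j + 1) := by
      rw [eq_div_iff h4, mul_comm, h']
    rw [h5]
    have h6 : (2 * ((j : ℚ) + 1) + 1) ≠ 0 := by positivity
    push_cast
    field_simp
    ring

theorem proposition7p2 (n : ℕ) (hn : 1 ≤ n) :
    -- the identity of rational functions in `ℚ(x)`
    (algebraMap ℚ[X] (RatFunc ℚ) (hankelDet n shiftedEulerPoly) =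
      (-1) ^ (n - 1) * (4 / ((n.factorial : RatFunc ℚ) ^ 2 * (RatFunc.X ^ 2 - 1))) *
        curlyK n (RatFunc.X : RatFunc ℚ) *
        algebraMap ℚ[X] (RatFunc ℚ) (hankelDet n fun k => eulerPolyHalf (2 * k))) ∧
    -- its values at all complex numbers at which no denominator vanishes
    (∀ x : ℂ, (∀ l ∈ Finset.Icc 1 n, x ^ 2 ≠ (2 * (l : ℂ) - 1) ^ 2) →
      hankelDet n (fun k => aeval x (shiftedEulerPoly k)) =
        (-1) ^ (n - 1) * (4 / ((n.factorial : ℂ) ^ 2 * (x ^ 2 - 1))) *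
          curlyK n x * hankelDet n (fun k => aeval x (eulerPolyHalf (2 * k)))) ∧
    -- the specialization to Euler numbers
    hankelDet n shiftedEulerNumber =
      (-1) ^ n / (4 ^ n * (n.factorial : ℚ) ^ 2) *
        (∑ j ∈ Finset.range n,
          (16 : ℚ) ^ j / ((2 * (j : ℚ) + 1) ^ 2 * ((2 * j).choose j : ℚ) ^ 2)) *
        hankelDet n (fun k => eulerNumber (2 * k)) := by
  refine ⟨?_, fun x hx => hankelDet_aeval_shiftedEulerPoly x hn hx, ?_⟩
  · have h := hankelDet_aeval_shiftedEulerPoly (RatFunc.X : RatFunc ℚ) hn (by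
      intro l _ h
      have h1 : algebraMap ℚ[X] (RatFunc ℚ) (X ^ 2) =
          algebraMap ℚ[X] (RatFunc ℚ) (C ((2 * (l : ℚ) - 1) ^ 2)) := by
        simpa using h
      -- Degree `2` against degree `0`.
      have h2 := congrArg natDegree (RatFunc.algebraMap_injective ℚ h1)
      simp [-map_pow] at h2)
    have h3 : ∀ p : ℚ[X], aeval (RatFunc.X : RatFunc ℚ) p = algebraMap ℚ[X] (RatFunc ℚ) p := by
      intro p
      rw [← RatFunc.algebraMap_X, aeval_algebraMap_apply, aeval_X_left_apply]
    simp only [h3] at h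
    rw [map_hankelDet, map_hankelDet, h]
  · have h := hankelDet_aeval_shiftedEulerPoly (0 : ℚ) hn (by
      intro l _ h
      have h1 : (2 * (l : ℚ) - 1) = 0 := by simpa using h.symm
      have h2 : (2 * (l : ℤ) - 1) = 0 := by exact_mod_cast h1
      omega)
    have hE : ∀ k, eulerNumber (2 * k) = 4 ^ k * aeval (0 : ℚ) (eulerPolyHalf (2 * k)) := by
      intro k
      rw [eulerNumber_eq, aeval_eulerPolyHalf, pow_mul, coe_aeval_eq_eval]
      norm_num
    -- The shift of index costs one factor `4`; the powers `4^k` scale both determinants equally, so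
    -- only `(1/4)^(n+1)` survives.
    have hs : shiftedEulerNumber = fun k =>
        (1 / 4) * (4 ^ k * aeval (0 : ℚ) (shiftedEulerPoly k)) := by
      funext k
      cases k with
      | zero => simp [shiftedEulerNumber, shiftedEulerPoly]
      | succ k => rw [shiftedEulerNumber, shiftedEulerPoly, hE]; ring
    rw [hs, hankelDet_const_mul, div_pow, one_pow, hankelDet_mul_pow, h, curlyK_eq_sum_range 0 hn]
    simp only [hE, prod_two_mul_sq_div]
    rw [hankelDet_mul_pow]
    obtain ⟨n, rfl⟩ := Nat.exists_eq_succ_of_ne_zero (by omega : n ≠ 0)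
    simp only [Nat.succ_eq_add_one, Nat.add_sub_cancel]
    have h1 : ((n + 1).factorial : ℚ) ≠ 0 := Nat.cast_ne_zero.2 (Nat.factorial_ne_zero _)
    generalize hankelDet (n + 1) (fun k => aeval (0 : ℚ) (eulerPolyHalf (2 * k))) = D
    generalize ∑ j ∈ Finset.range (n + 1),
      (16 : ℚ) ^ j / ((2 * (j : ℚ) + 1) ^ 2 * ((2 * j).choose j : ℚ) ^ 2) = S
    field_simp
    ring
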